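/- Let $S$ be a Polish space with its Borel $\sigma$-field, let $n\ge 1$, let $\mu_1,\dots,\mu_n$ be Borel probability measures on $S$ and put $\mu=\mu_1\otimes\cdots\otimes\mu_n$ on $S^n$. Let $\gamma_1,\dots,\gamma_n>0$ be real numbers with $\sum_{i=1}^n\gamma_i=1$, and let $\Gamma_j=\sum_{k=1}^j\gamma_k$. For a probability measure $\nu$ on $S^n$ let $\nu^{(j)}$ denote its marginal on the first $j$ coordinates, and let $H(\cdot\mid\cdot)\in[0,\infty]$ denote relative entropy. For $1\le j\le n$ put $$\mathcal R_j=\{\nu\ \text{a probability measure on } S^n:\ H(\nu^{(j)}\mid\mu^{(j)})\le\Gamma_j\log 2\}.$$ Let $\phi:S^n\to\mathbb R$ be bounded and continuous, and put $$\operatorname{Gibbs}(\nu,\phi)=\int\phi\,d\nu-H(\nu\mid\mu)\in[-\infty,\infty).$$ Let $\Delta$ be the set of $\mathbf m=(m_1,\dots,m_n)\in\mathbb R^n$ with $0<m_1\le m_2\le\cdots\le m_n\le 1$. For $\mathbf m\in\Delta$ define $\phi_j:S^j\to\mathbb R$, $0\le j\le n$, by $\phi_n=\phi$ and $$\phi_{j-1}(x_1,\dots,x_{j-1})=\frac1{m_j}\log\int\exp\bigl[m_j\phi_j(x_1,\dots,x_{j-1},x_j)\bigr]\,\mu_j(dx_j),\qquad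 1\le j\le n,$$ so that $\phi_0=\phi_0(\mathbf m)$ is a real number, and put $$\operatorname{Parisi}(\mathbf m,\phi)=\sum_{i=1}^n\frac{\gamma_i\log2}{m_i}+\phi_0(\mathbf m)-\log 2 .$$ Let $G_{\phi,\mathbf m}=K_1\otimes K_2\otimes\cdots\otimes K_n$ be the probability measure on $S^n$ that is the semi-direct product of the Markov kernels $K_j$ from $S^{j-1}$ to $S$, $$K_j(x_1,\dots,x_{j-1},dx_j)=\frac{\exp[m_j\phi_j(x_1,\dots,x_j)]}{\exp[m_j\phi_{j-1}(x_1,\dots,x_{j-1})]}\,\mu_j(dx_j),\qquad 1\le j\le n,$$ where $K_1$ is simply a probability measure on $S$. Then there is a unique $\nu\in\bigcap_{j=1}^n\mathcal R_j$ that maximizes $\operatorname{Gibbs}(\cdot,\phi)$ over $\bigcap_{j=1}^n\mathcal R_j$, and there is a unique $\mathbf m\in\Delta$ that minimizes $\operatorname{Parisi}(\cdot,\phi)$ over $\Delta$. For this $\nu$ and this $\mathbf m$ one has $$\nu=G_{\phi,\mathbf m}\qquad\text{and}\qquad \operatorname{Gibbs}(G_{\phi,\mathbf m},\phi)=\operatorname{Parisi}(\mathbf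 m,\phi).$$ -/

import Mathlib

open MeasureTheory ProbabilityTheory

namespace PerceptronGREM

noncomputable section

variable {S : Type*} {n : ℕ}

/-- The set `Δ` of parameters `0 < m₁ ≤ m₂ ≤ ⋯ ≤ mₙ ≤ 1` (the coordinate `m_{j+1}` is `m j`
for `j : Fin n`; the same shift of indices applies to `μ` and `γ`). -/
def Delta (n : ℕ) : Set (Fin n → ℝ) :=
  {m | (∀ j, 0 < m j) ∧ Monotone m ∧ ∀ j, m j ≤ 1}

/-- The partial sums `γ₁ + ⋯ + γ_{j+1}`, for `j : Fin n`. -/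
def Gam (γ : Fin n → ℝ) (j : Fin n) : ℝ := ∑ k ∈ Finset.Iic j, γ k

section

variable [MeasurableSpace S]

/-- The marginal `ν^{(j)}` of a measure on `Sⁿ` on the first `j` coordinates. -/
def marginal (ν : Measure (Fin n → S)) (j : ℕ) (hj : j ≤ n) : Measure (Fin j → S) :=
  ν.map (fun x i => x (Fin.castLE hj i))

/-- The constraint set: `H(ν^{(j+1)} | μ^{(j+1)}) ≤ (γ₁ + ⋯ + γ_{j+1}) log 2`, for `j : Fin n`,
where `μ = μ₁ ⊗ ⋯ ⊗ μₙ`. -/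
def R (μ : Fin n → Measure S) (γ : Fin n → ℝ) (j : Fin n) : Set (ProbabilityMeasure (Fin n → S)) :=
  {ν | InformationTheory.klDiv (marginal (ν : Measure (Fin n → S)) (j + 1) j.isLt)
      (marginal (Measure.pi μ) (j + 1) j.isLt) ≤ ENNReal.ofReal (Gam γ j * Real.log 2)}

/-- `Gibbs(ν, φ) = ∫ φ dν - H(ν | μ)`, with values in `[-∞, ∞)` for bounded measurable `φ`. -/
def gibbs (μ : Fin n → Measure S) (φ : (Fin n → S) → ℝ) (ν : ProbabilityMeasure (Fin n → S)) :
    EReal :=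
  ((∫ x, φ x ∂(ν : Measure (Fin n → S)) : ℝ) : EReal) -
    (InformationTheory.klDiv (ν : Measure (Fin n → S)) (Measure.pi μ) : EReal)

/-- The functions `φ_j : S^j → ℝ` for `0 ≤ j ≤ n`, by downward recursion from `φ_n = φ`
(see `phi_self` and `phi_pred` for the defining equations). -/
def phi (μ : Fin n → Measure S) (m : Fin n → ℝ) (φ : (Fin n → S) → ℝ) (j : ℕ) (hj : j ≤ n) :
    (Fin j → S) → ℝ :=
  Nat.decreasingInduction (motive := fun j _ => (Fin j → S) → ℝ)
    (fun k hk f x => 1 / m ⟨k, hk⟩ *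
      Real.log (∫ y, Real.exp (m ⟨k, hk⟩ * f (Fin.snoc (α := fun _ => S) x y)) ∂(μ ⟨k, hk⟩)))
    φ hj

theorem phi_self (μ : Fin n → Measure S) (m : Fin n → ℝ) (φ : (Fin n → S) → ℝ) :
    phi μ m φ n le_rfl = φ := by
  simp [phi]

theorem phi_pred (μ : Fin n → Measure S) (m : Fin n → ℝ) (φ : (Fin n → S) → ℝ)
    (j : ℕ) (hj : j < n) (x : Fin j → S) :
    phi μ m φ j hj.le x = 1 / m ⟨j, hj⟩ *
      Real.log (∫ y, Real.exp (m ⟨j, hj⟩ *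
        phi μ m φ (j + 1) hj (Fin.snoc (α := fun _ => S) x y)) ∂(μ ⟨j, hj⟩)) := by
  unfold phi
  rw [Nat.decreasingInduction_succ_left]

/-- `Parisi(m, φ) = ∑ᵢ γᵢ log 2 / mᵢ + φ₀(m) - log 2`. -/
def parisi (μ : Fin n → Measure S) (γ : Fin n → ℝ) (φ : (Fin n → S) → ℝ) (m : Fin n → ℝ) : ℝ :=
  ∑ i, γ i * Real.log 2 / m i + phi μ m φ 0 (Nat.zero_le n) Fin.elim0 - Real.log 2

/-- The Markov kernel `K_{j+1}` from `S^j` to `S`, for `0 ≤ j < n`: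
`K_{j+1}(x, dy) = exp(m_{j+1} φ_{j+1}(x, y)) / exp(m_{j+1} φ_j(x)) μ_{j+1}(dy)`.
For `j = 0` it is (a kernel from the one-point space given by) the starting measure. -/
def K (μ : Fin n → Measure S) [∀ i, IsProbabilityMeasure (μ i)] (m : Fin n → ℝ)
    (φ : (Fin n → S) → ℝ) (j : ℕ) (hj : j < n) : Kernel (Fin j → S) S :=
  (Kernel.const (Fin j → S) (μ ⟨j, hj⟩)).withDensity
    (fun x y => ENNReal.ofReal
      (Real.exp (m ⟨j, hj⟩ * phi μ m φ (j + 1) hj (Fin.snoc (α := fun _ => S) x y)) /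
        Real.exp (m ⟨j, hj⟩ * phi μ m φ j hj.le x)))

/-- The semi-direct product `G^{(j)} = K₁ ⊗ K₂ ⊗ ⋯ ⊗ K_j` on `S^j`; on the one-point space `S⁰` it
is the point mass. -/
def chain (μ : Fin n → Measure S) [∀ i, IsProbabilityMeasure (μ i)] (m : Fin n → ℝ)
    (φ : (Fin n → S) → ℝ) : (j : ℕ) → j ≤ n → Measure (Fin j → S)
  | 0, _ => Measure.dirac Fin.elim0
  | j + 1, hj =>
    ((chain μ m φ j (Nat.le_of_succ_le hj)).compProd (K μ m φ j hj)).map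
      (fun p => Fin.snoc (α := fun _ => S) p.1 p.2)

/-- The measure `G_{φ,m} = K₁ ⊗ K₂ ⊗ ⋯ ⊗ Kₙ` on `Sⁿ`. -/
def G (μ : Fin n → Measure S) [∀ i, IsProbabilityMeasure (μ i)] (φ : (Fin n → S) → ℝ)
    (m : Fin n → ℝ) : Measure (Fin n → S) :=
  chain μ m φ n le_rfl

end

end

end PerceptronGREM

/-! This is convex duality with multipliers `λ_j = 1/m_j - 1/m_{j+1} ≥ 0`, where `m_{n+1} = 1`. Let
`L_j` be the log-density of the first `j` coordinates under `G_m`. Telescoping the recursion for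
`φ_j` and summing by parts gives `φ = φ₀ + ∑ λ_j L_j + L_n`. Since `∫ L_j dν = H(ν^(j)|μ^(j)) -
H(ν^(j)|G^(j))`, this integrates to (`integral_sub_ent_eq`) `Gibbs(ν) = φ₀ + ∑ λ_j (H(ν^(j)|μ^(j)) -
H(ν^(j)|G^(j))) - H(ν|G)`, while `Parisi(m) = φ₀ + ∑ λ_j Γ_j log 2`. Hence `Gibbs(ν) + H(ν|G_m) ≤
Parisi(m)` under the constraints.

Testing the identity for `m` at `ν = G_m'` shows that `Parisi` is convex in `λ`, with subgradient
`Γ_j log 2 - H(G^(j)|μ^(j))` (`parisi_sub_le`). At a minimizer, which exists by compactness, `G_m`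
is therefore feasible and satisfies complementary slackness (`ent_G_le_of_isMinOn`). So the duality
gap vanishes, and the term `H(ν|G)` forces every maximizer to equal `G_m`.

Two minimizers thus share the same `G`. If they differed, some coordinate would add no entropy
although its constraint is tight, against `Γ_{j-1} < Γ_j` (`eq_of_G_eq`). -/

namespace PerceptronGREM

/-! ### Relative entropy and bounded exponential tilting. -/

section Entropy

variable {α : Type*} [MeasurableSpace α]

theorem integrable_of_abs_le {ν : Measure α} [IsFiniteMeasure ν] {f : α → ℝ} (hf : Measurable f)
    {C : ℝ} (hC : ∀ x, |f x| ≤ C) : Integrable f ν :=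
  Integrable.of_bound hf.aestronglyMeasurable C (Filter.Eventually.of_forall hC)

theorem integrable_exp_of_abs_le {ν : Measure α} [IsFiniteMeasure ν] {f : α → ℝ}
    (hf : Measurable f) {C : ℝ} (hC : ∀ x, |f x| ≤ C) :
    Integrable (fun x => Real.exp (f x)) ν :=
  integrable_of_abs_le (C := Real.exp C) hf.exp fun x => by
    rw [abs_of_pos (Real.exp_pos _)]
    exact Real.exp_le_exp.2 ((le_abs_self _).trans (hC x))

/-- The log-likelihood ratios against `μ` and against `e^f μ` differ by `f`; integrate against `ν`.
-/
theorem toReal_klDiv_eq_integral_add {ν μ : Measure α} [IsProbabilityMeasure ν]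
    [IsProbabilityMeasure μ] {f : α → ℝ} (hf : Measurable f) {C : ℝ} (hC : ∀ x, |f x| ≤ C)
    (hexp : ∫ x, Real.exp (f x) ∂μ = 1) (hfin : InformationTheory.klDiv ν μ ≠ ⊤) :
    (InformationTheory.klDiv ν μ).toReal =
      ∫ x, f x ∂ν + (InformationTheory.klDiv ν (μ.tilted f)).toReal := by
  obtain ⟨hac, hint⟩ := InformationTheory.klDiv_ne_top_iff.1 hfin
  have hfe : Integrable (fun x => Real.exp (f x)) μ := integrable_exp_of_abs_le hf hC
  have := isProbabilityMeasure_tilted hfe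
  have hac' : ν ≪ μ.tilted f := hac.trans (absolutelyContinuous_tilted hfe)
  rw [InformationTheory.toReal_klDiv_of_measure_eq hac (by simp),
    InformationTheory.toReal_klDiv_of_measure_eq hac' (by simp),
    integral_llr_tilted_right hac (integrable_of_abs_le hf hC) hfe hint, hexp]
  simp

theorem klDiv_tilted_ne_top {ν μ : Measure α} [IsProbabilityMeasure ν]
    [IsProbabilityMeasure μ] {f : α → ℝ} (hf : Measurable f) {C : ℝ} (hC : ∀ x, |f x| ≤ C)
    (hfin : InformationTheory.klDiv ν μ ≠ ⊤) :
    InformationTheory.klDiv ν (μ.tilted f) ≠ ⊤ := by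
  obtain ⟨hac, hint⟩ := InformationTheory.klDiv_ne_top_iff.1 hfin
  have hfe : Integrable (fun x => Real.exp (f x)) μ := integrable_exp_of_abs_le hf hC
  exact InformationTheory.klDiv_ne_top (hac.trans (absolutelyContinuous_tilted hfe))
    (integrable_llr_tilted_right hac (integrable_of_abs_le hf hC) hint hfe)

theorem klDiv_tilted_self_ne_top {μ : Measure α}
    [IsProbabilityMeasure μ] {f : α → ℝ} (hf : Measurable f) {C : ℝ} (hC : ∀ x, |f x| ≤ C) :
    InformationTheory.klDiv (μ.tilted f) μ ≠ ⊤ := by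
  have hfe : Integrable (fun x => Real.exp (f x)) μ := integrable_exp_of_abs_le hf hC
  have := isProbabilityMeasure_tilted hfe
  have hac := tilted_absolutelyContinuous μ f
  refine InformationTheory.klDiv_ne_top hac ?_
  have h := llr_tilted_left Measure.AbsolutelyContinuous.rfl hfe hf.aemeasurable
  have h' : llr (μ.tilted f) μ =ᵐ[μ] fun x => f x - Real.log (∫ z, Real.exp (f z) ∂μ) := by
    filter_upwards [h, llr_self μ] with x hx hx'
    rw [hx, hx', Pi.zero_apply, add_zero]
  rw [integrable_congr (hac.ae_eq h')]
  exact (integrable_of_abs_le hf hC).sub (integrable_const _)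

end Entropy

/-! ### Prefixes, and marginals of product measures. -/

section Prefix

variable {S : Type*} {n : ℕ}

/-- The first `j` coordinates of a point of `Sⁿ`. -/
def pre {k j : ℕ} (hj : j ≤ k) (x : Fin k → S) : Fin j → S := fun i => x (Fin.castLE hj i)

@[simp]
theorem pre_self (h : n ≤ n) (x : Fin n → S) : pre h x = x := rfl

theorem pre_snoc {k j : ℕ} (hj : j ≤ k) (x : Fin k → S) (y : S) :
    pre (hj.trans k.le_succ) (Fin.snoc (α := fun _ => S) x y : Fin (k + 1) → S) = pre hj x := by
  ext i
  have : Fin.castLE (hj.trans k.le_succ) i = (Fin.castLE hj i).castSucc := rfl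
  simp only [pre, this, Fin.snoc_castSucc]

variable [MeasurableSpace S]

theorem measurable_pre {k j : ℕ} (hj : j ≤ k) : Measurable (pre hj : (Fin k → S) → Fin j → S) :=
  measurable_pi_iff.2 fun _ => measurable_pi_apply _

theorem measurable_snoc {j : ℕ} :
    Measurable fun p : (Fin j → S) × S => (Fin.snoc (α := fun _ => S) p.1 p.2 : Fin (j + 1) → S) := by
  refine measurable_pi_iff.2 fun i => ?_
  refine Fin.lastCases ?_ (fun i => ?_) i
  · simpa using measurable_snd
  · simp only [Fin.snoc_castSucc]
    exact (measurable_pi_apply i).comp measurable_fst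

theorem marginal_eq_map (ν : Measure (Fin n → S)) (j : ℕ) (hj : j ≤ n) :
    marginal ν j hj = ν.map (pre hj) := rfl

theorem marginal_self (ν : Measure (Fin n → S)) (h : n ≤ n) : marginal ν n h = ν :=
  Measure.map_id

instance (ν : Measure (Fin n → S)) [IsProbabilityMeasure ν] (j : ℕ) (hj : j ≤ n) :
    IsProbabilityMeasure (marginal ν j hj) :=
  Measure.isProbabilityMeasure_map (measurable_pre hj).aemeasurable

theorem integral_marginal (ν : Measure (Fin n → S)) {j : ℕ} (hj : j ≤ n) {f : (Fin j → S) → ℝ}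
    (hf : Measurable f) : ∫ x, f x ∂(marginal ν j hj) = ∫ x, f (pre hj x) ∂ν :=
  integral_map (measurable_pre hj).aemeasurable hf.aestronglyMeasurable

theorem map_snoc_prod {j : ℕ} (μ : Fin (j + 1) → Measure S) [∀ i, IsProbabilityMeasure (μ i)] :
    ((Measure.pi fun i : Fin j => μ i.castSucc).prod (μ (Fin.last j))).map
      (fun p => (Fin.snoc (α := fun _ => S) p.1 p.2 : Fin (j + 1) → S)) = Measure.pi μ := by
  refine (Measure.pi_eq fun s hs => ?_).symm
  rw [Measure.map_apply measurable_snoc (MeasurableSet.univ_pi hs)]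
  have : (fun p : (Fin j → S) × S => (Fin.snoc (α := fun _ => S) p.1 p.2 : Fin (j + 1) → S)) ⁻¹'
      Set.univ.pi s = (Set.univ.pi fun i : Fin j => s i.castSucc) ×ˢ s (Fin.last j) := by
    ext p
    simp [Set.mem_pi, Fin.forall_fin_succ']
  rw [this, Measure.prod_prod, Measure.pi_pi, Fin.prod_univ_castSucc]

theorem marginal_pi (μ : Fin n → Measure S) [∀ i, IsProbabilityMeasure (μ i)] (j : ℕ)
    (hj : j ≤ n) :
    marginal (Measure.pi μ) j hj = Measure.pi fun i : Fin j => μ (Fin.castLE hj i) := by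
  induction n with
  | zero =>
    obtain rfl : j = 0 := by omega
    exact marginal_self _ _
  | succ k ih =>
    rcases hj.lt_or_eq with h | rfl
    · have hk : j ≤ k := by omega
      rw [← map_snoc_prod μ, marginal_eq_map, Measure.map_map (measurable_pre hj) measurable_snoc]
      have : (pre hj ∘ fun p : (Fin k → S) × S =>
          (Fin.snoc (α := fun _ => S) p.1 p.2 : Fin (k + 1) → S)) = pre hk ∘ Prod.fst := by
        ext1 p
        exact pre_snoc hk p.1 p.2
      rw [this, ← Measure.map_map (measurable_pre hk) measurable_fst, ← Measure.fst,
        Measure.fst_prod]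
      exact ih (fun i => μ i.castSucc) hk
    · exact marginal_self _ _

end Prefix

end PerceptronGREM

namespace PerceptronGREM

/-! ### Log-densities of the chain. -/

section LogDensity

variable {S : Type*} [MeasurableSpace S] {n : ℕ}
  (μ : Fin n → Measure S) (m : Fin n → ℝ) (φ : (Fin n → S) → ℝ)

/-- The logarithm of the conditional density of the coordinate `i` under `G_{φ,m}`. -/
noncomputable def incr (i : Fin n) (x : Fin n → S) : ℝ :=
  m i * (phi μ m φ (i + 1) i.isLt (pre i.isLt x) - phi μ m φ i i.isLt.le (pre i.isLt.le x))

/-- The logarithm of the density of the law of the first `j` coordinates under `G_{φ,m}`. -/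
noncomputable def logDensity (j : ℕ) (hj : j ≤ n) (x : Fin j → S) : ℝ :=
  ∑ i : Fin j, m (Fin.castLE hj i) *
    (phi μ m φ (i + 1) (i.isLt.trans_le hj) (pre i.isLt x) -
      phi μ m φ i (i.isLt.le.trans hj) (pre i.isLt.le x))

theorem logDensity_pre (j : ℕ) (hj : j ≤ n) (x : Fin n → S) :
    logDensity μ m φ j hj (pre hj x) = ∑ i : Fin j, incr μ m φ (Fin.castLE hj i) x := rfl

theorem logDensity_succ_pre (j : Fin n) (x : Fin n → S) :
    logDensity μ m φ (j + 1) j.isLt (pre j.isLt x) =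
      logDensity μ m φ j j.isLt.le (pre j.isLt.le x) + incr μ m φ j x := by
  rw [logDensity_pre, logDensity_pre, Fin.sum_univ_castSucc]
  rfl

theorem logDensity_snoc (j : ℕ) (hj : j < n) (x : Fin j → S) (y : S) :
    logDensity μ m φ (j + 1) hj (Fin.snoc (α := fun _ => S) x y) = logDensity μ m φ j hj.le x +
      m ⟨j, hj⟩ * (phi μ m φ (j + 1) hj (Fin.snoc (α := fun _ => S) x y) -
        phi μ m φ j hj.le x) := by
  unfold logDensity
  rw [Fin.sum_univ_castSucc]
  congr 1
  · refine Finset.sum_congr rfl fun i _ => ?_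
    have h1 := pre_snoc (k := j) i.isLt x y
    have h2 := pre_snoc (k := j) i.isLt.le x y
    simp only [Fin.val_castSucc]
    rw [h1, h2]
    rfl
  · have h := pre_snoc (k := j) le_rfl x y
    simp only [Fin.val_last]
    rw [h]
    rfl

end LogDensity

/-! ### Measurability, bounds and continuity in `m` of `phi`. -/

section Phi

variable {S : Type*} [MeasurableSpace S] {n : ℕ}

/-- An exponential mean of `f` lies between any two bounds of `f`, so the recursion for `phi`
preserves the bound on `φ`. -/
theorem abs_inv_mul_log_integral_exp_le {ν : Measure S} [IsProbabilityMeasure ν] {f : S → ℝ}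
    (hf : Measurable f) {C a : ℝ} (ha : 0 < a) (hC : ∀ x, |f x| ≤ C) :
    |1 / a * Real.log (∫ y, Real.exp (a * f y) ∂ν)| ≤ C := by
  have hint : Integrable (fun y => Real.exp (a * f y)) ν :=
    integrable_exp_of_abs_le (C := a * C) (hf.const_mul a) fun x => by
      rw [abs_mul, abs_of_pos ha]
      exact mul_le_mul_of_nonneg_left (hC x) ha.le
  have hup : ∫ y, Real.exp (a * f y) ∂ν ≤ Real.exp (a * C) := by
    refine (integral_mono hint (integrable_const (Real.exp (a * C))) fun y => ?_).trans_eq (by simp)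
    exact Real.exp_le_exp.2 (mul_le_mul_of_nonneg_left (abs_le.1 (hC y)).2 ha.le)
  have hlo : Real.exp (a * -C) ≤ ∫ y, Real.exp (a * f y) ∂ν := by
    refine (by simp : _ = ∫ _, Real.exp (a * -C) ∂ν).trans_le
      (integral_mono (integrable_const _) hint fun y => ?_)
    exact Real.exp_le_exp.2 (mul_le_mul_of_nonneg_left (abs_le.1 (hC y)).1 ha.le)
  have hpos := (Real.exp_pos _).trans_le hlo
  rw [one_div, inv_mul_eq_div, abs_le, le_div_iff₀ ha, div_le_iff₀ ha]
  exact ⟨by linarith [(Real.le_log_iff_exp_le hpos).2 hlo],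
    by linarith [(Real.log_le_iff_le_exp hpos).2 hup]⟩

variable (μ : Fin n → Measure S) [∀ i, IsProbabilityMeasure (μ i)] {m : Fin n → ℝ}
  {φ : (Fin n → S) → ℝ} {C : ℝ}

theorem measurable_phi (m : Fin n → ℝ) (hφ : Measurable φ) (j : ℕ) (hj : j ≤ n) :
    Measurable (phi μ m φ j hj) := by
  induction hj using Nat.decreasingInduction with
  | self => rwa [phi_self]
  | of_succ k hk ih =>
    have h : Measurable fun p : (Fin k → S) × S => Real.exp (m ⟨k, hk⟩ *
        phi μ m φ (k + 1) hk (Fin.snoc (α := fun _ => S) p.1 p.2)) :=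
      ((ih.comp measurable_snoc).const_mul _).exp
    have := h.stronglyMeasurable.integral_prod_right' (ν := μ ⟨k, hk⟩)
    rw [funext (phi_pred μ m φ k hk)]
    exact this.measurable.log.const_mul _

theorem measurable_phi_snoc (m : Fin n → ℝ) (hφ : Measurable φ) (j : ℕ) (hj : j < n)
    (x : Fin j → S) :
    Measurable fun y => phi μ m φ (j + 1) hj (Fin.snoc (α := fun _ => S) x y) :=
  (measurable_phi μ m hφ (j + 1) hj).comp (measurable_snoc.comp measurable_prodMk_left)

theorem abs_phi_le (hm : ∀ i, 0 < m i) (hφ : Measurable φ) (hC : ∀ x, |φ x| ≤ C) (j : ℕ)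
    (hj : j ≤ n) (x : Fin j → S) : |phi μ m φ j hj x| ≤ C := by
  induction hj using Nat.decreasingInduction with
  | self => rw [phi_self]; exact hC x
  | of_succ k hk ih =>
    rw [phi_pred]
    exact abs_inv_mul_log_integral_exp_le (measurable_phi_snoc μ m hφ k hk x) (hm _) fun _ => ih _

theorem integrable_exp_phi_snoc (hm : ∀ i, 0 < m i) (hφ : Measurable φ) (hC : ∀ x, |φ x| ≤ C)
    (j : ℕ) (hj : j < n) (x : Fin j → S) :
    Integrable (fun y => Real.exp (m ⟨j, hj⟩ *
      phi μ m φ (j + 1) hj (Fin.snoc (α := fun _ => S) x y))) (μ ⟨j, hj⟩) :=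
  integrable_exp_of_abs_le (C := m ⟨j, hj⟩ * C) ((measurable_phi_snoc μ m hφ j hj x).const_mul _)
    fun y => by
      rw [abs_mul, abs_of_pos (hm _)]
      exact mul_le_mul_of_nonneg_left (abs_phi_le μ hm hφ hC _ _ _) (hm _).le

theorem exp_mul_phi (hm : ∀ i, 0 < m i) (hφ : Measurable φ) (hC : ∀ x, |φ x| ≤ C)
    (j : ℕ) (hj : j < n) (x : Fin j → S) :
    Real.exp (m ⟨j, hj⟩ * phi μ m φ j hj.le x) =
      ∫ y, Real.exp (m ⟨j, hj⟩ *
        phi μ m φ (j + 1) hj (Fin.snoc (α := fun _ => S) x y)) ∂(μ ⟨j, hj⟩) := by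
  rw [phi_pred, ← mul_assoc, mul_one_div_cancel (hm _).ne', one_mul, Real.exp_log]
  exact integral_exp_pos (integrable_exp_phi_snoc μ hm hφ hC j hj x)

theorem continuousOn_phi (hφ : Measurable φ) (hC : ∀ x, |φ x| ≤ C) (j : ℕ) (hj : j ≤ n)
    (x : Fin j → S) : ContinuousOn (fun m => phi μ m φ j hj x) (Delta n) := by
  induction hj using Nat.decreasingInduction with
  | self => exact (continuousOn_const (c := φ x)).congr fun m _ => by rw [phi_self]
  | of_succ k hk ih =>
    have hfun : (fun m => phi μ m φ k hk.le x) = fun m => 1 / m ⟨k, hk⟩ * Real.log (∫ y,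
        Real.exp (m ⟨k, hk⟩ * phi μ m φ (k + 1) hk (Fin.snoc (α := fun _ => S) x y))
          ∂(μ ⟨k, hk⟩)) := funext fun m => phi_pred μ m φ k hk x
    rw [hfun]
    have hcoord : ContinuousOn (fun m : Fin n → ℝ => m ⟨k, hk⟩) (Delta n) :=
      (continuous_apply _).continuousOn
    refine (continuousOn_const.div hcoord fun m hm => (hm.1 _).ne').mul
      (ContinuousOn.log ?_ fun m hm =>
        (integral_exp_pos (integrable_exp_phi_snoc μ hm.1 hφ hC k hk x)).ne')
    -- The bound `exp C` is uniform in `m` because all coordinates are at most `1` on `Delta n`.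
    refine continuousOn_of_dominated (bound := fun _ => Real.exp C) (fun m hm => ?_)
      (fun m hm => Filter.Eventually.of_forall fun y => ?_) (integrable_const _)
      (Filter.Eventually.of_forall fun y => ?_)
    · exact ((measurable_phi_snoc μ m hφ k hk x).const_mul _).exp.aestronglyMeasurable
    · have h := abs_phi_le μ hm.1 hφ hC (k + 1) hk (Fin.snoc (α := fun _ => S) x y)
      rw [Real.norm_eq_abs, abs_of_pos (Real.exp_pos _)]
      refine Real.exp_le_exp.2 ((le_abs_self _).trans ?_)
      rw [abs_mul, abs_of_pos (hm.1 _)]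
      exact (mul_le_of_le_one_left (abs_nonneg _) (hm.2.2 _)).trans h
    · exact (hcoord.mul (ih _)).rexp

theorem measurable_incr (m : Fin n → ℝ) (hφ : Measurable φ) (i : Fin n) :
    Measurable (incr μ m φ i) :=
  (((measurable_phi μ m hφ _ _).comp (measurable_pre _)).sub
    ((measurable_phi μ m hφ _ _).comp (measurable_pre _))).const_mul _

theorem measurable_logDensity (m : Fin n → ℝ) (hφ : Measurable φ) (j : ℕ) (hj : j ≤ n) :
    Measurable (logDensity μ m φ j hj) :=
  Finset.measurable_fun_sum _ fun _ _ => (((measurable_phi μ m hφ _ _).comp (measurable_pre _)).sub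
    ((measurable_phi μ m hφ _ _).comp (measurable_pre _))).const_mul _

theorem abs_mul_sub_le {a u v C : ℝ} (ha : 0 < a) (ha' : a ≤ 1) (hu : |u| ≤ C) (hv : |v| ≤ C) :
    |a * (u - v)| ≤ 2 * C := by
  rw [abs_mul, abs_of_pos ha]
  have h := (abs_sub u v).trans (add_le_add hu hv)
  exact (mul_le_of_le_one_left (abs_nonneg _) ha').trans (by linarith)

theorem abs_incr_le (hm : m ∈ Delta n) (hφ : Measurable φ) (hC : ∀ x, |φ x| ≤ C) (i : Fin n)
    (x : Fin n → S) : |incr μ m φ i x| ≤ 2 * C :=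
  abs_mul_sub_le (hm.1 _) (hm.2.2 _) (abs_phi_le μ hm.1 hφ hC _ _ _)
    (abs_phi_le μ hm.1 hφ hC _ _ _)

theorem abs_logDensity_le (hm : m ∈ Delta n) (hφ : Measurable φ) (hC : ∀ x, |φ x| ≤ C) (j : ℕ)
    (hj : j ≤ n) (x : Fin j → S) : |logDensity μ m φ j hj x| ≤ j * (2 * C) := by
  refine (Finset.abs_sum_le_sum_abs _ _).trans ?_
  refine (Finset.sum_le_sum fun i _ => abs_mul_sub_le (hm.1 _) (hm.2.2 _)
    (abs_phi_le μ hm.1 hφ hC _ _ _) (abs_phi_le μ hm.1 hφ hC _ _ _)).trans_eq ?_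
  simp

theorem continuousOn_logDensity (hφ : Measurable φ) (hC : ∀ x, |φ x| ≤ C) (j : ℕ) (hj : j ≤ n)
    (x : Fin j → S) : ContinuousOn (fun m => logDensity μ m φ j hj x) (Delta n) :=
  continuousOn_finsetSum _ fun _ _ => (continuous_apply _).continuousOn.mul
    ((continuousOn_phi μ hφ hC _ _ _).sub (continuousOn_phi μ hφ hC _ _ _))

end Phi

/-! ### The chain as a tilted product measure. -/

section Chain

variable {S : Type*} [MeasurableSpace S] {n : ℕ}
variable (μ : Fin n → Measure S) [∀ i, IsProbabilityMeasure (μ i)] {m : Fin n → ℝ}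
  {φ : (Fin n → S) → ℝ} {C : ℝ}

theorem measurable_density (m : Fin n → ℝ) (hφ : Measurable φ) (j : ℕ) (hj : j < n) :
    Measurable (Function.uncurry fun (x : Fin j → S) y => ENNReal.ofReal
      (Real.exp (m ⟨j, hj⟩ * phi μ m φ (j + 1) hj (Fin.snoc (α := fun _ => S) x y)) /
        Real.exp (m ⟨j, hj⟩ * phi μ m φ j hj.le x))) :=
  ((((measurable_phi μ m hφ (j + 1) hj).comp measurable_snoc).const_mul _).exp.div
    (((measurable_phi μ m hφ j hj.le).comp measurable_fst).const_mul _).exp).ennreal_ofReal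

theorem isMarkovKernel_K (hm : ∀ i, 0 < m i) (hφ : Measurable φ) (hC : ∀ x, |φ x| ≤ C)
    (j : ℕ) (hj : j < n) : IsMarkovKernel (K μ m φ j hj) := by
  refine ⟨fun x => ⟨?_⟩⟩
  rw [K, Kernel.withDensity_apply _ (measurable_density μ m hφ j hj), Kernel.const_apply,
    withDensity_apply _ MeasurableSet.univ, Measure.restrict_univ,
    ← ofReal_integral_eq_lintegral_ofReal
      ((integrable_exp_phi_snoc μ hm hφ hC j hj x).div_const _)
      (Filter.Eventually.of_forall fun y => by positivity),
    integral_div, ← exp_mul_phi μ hm hφ hC, div_self (Real.exp_pos _).ne', ENNReal.ofReal_one]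

theorem isProbabilityMeasure_chain (hm : ∀ i, 0 < m i) (hφ : Measurable φ)
    (hC : ∀ x, |φ x| ≤ C) (j : ℕ) (hj : j ≤ n) : IsProbabilityMeasure (chain μ m φ j hj) := by
  induction j with
  | zero => rw [chain]; infer_instance
  | succ k ih =>
    have := ih (Nat.le_of_succ_le hj)
    have := isMarkovKernel_K μ hm hφ hC k hj
    rw [chain]
    exact Measure.isProbabilityMeasure_map measurable_snoc.aemeasurable

/-- The kernels are Markov, so forgetting the last coordinate removes the last kernel. -/
theorem map_pre_chain (hm : ∀ i, 0 < m i) (hφ : Measurable φ) (hC : ∀ x, |φ x| ≤ C)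
    (k : ℕ) (hk : k ≤ n) (j : ℕ) (hj : j ≤ k) :
    (chain μ m φ k hk).map (pre hj) = chain μ m φ j (hj.trans hk) := by
  induction k, hj using Nat.le_induction with
  | base => exact Measure.map_id
  | succ k hjk ih =>
    have := isMarkovKernel_K μ hm hφ hC k hk
    have := isProbabilityMeasure_chain μ hm hφ hC k (Nat.le_of_succ_le hk)
    rw [chain, Measure.map_map (measurable_pre _) measurable_snoc]
    have : (pre (hjk.trans k.le_succ) ∘ fun p : (Fin k → S) × S =>
        (Fin.snoc (α := fun _ => S) p.1 p.2 : Fin (k + 1) → S)) = pre hjk ∘ Prod.fst := by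
      ext1 p
      exact pre_snoc hjk p.1 p.2
    rw [this, ← Measure.map_map (measurable_pre hjk) measurable_fst, ← Measure.fst,
      Measure.fst_compProd]
    exact ih _

theorem chain_eq_withDensity (hm : ∀ i, 0 < m i) (hφ : Measurable φ)
    (hC : ∀ x, |φ x| ≤ C) (j : ℕ) (hj : j ≤ n) :
    chain μ m φ j hj = (Measure.pi fun i : Fin j => μ (Fin.castLE hj i)).withDensity
      fun x => ENNReal.ofReal (Real.exp (logDensity μ m φ j hj x)) := by
  induction j with
  | zero =>
    simp [chain, logDensity, Measure.pi_of_empty _ Fin.elim0]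
  | succ k ih =>
    have := isMarkovKernel_K μ hm hφ hC k hj
    have := isProbabilityMeasure_chain μ hm hφ hC k (Nat.le_of_succ_le hj)
    have hld := fun j hj => (measurable_logDensity μ m hφ j hj).exp.ennreal_ofReal
    refine Measure.ext_of_lintegral _ fun f hf => ?_
    have hfs : Measurable fun p : (Fin k → S) × S => f (Fin.snoc (α := fun _ => S) p.1 p.2) :=
      hf.comp measurable_snoc
    rw [chain, lintegral_map hf measurable_snoc, Measure.lintegral_compProd hfs, ih,
      lintegral_withDensity_eq_lintegral_mul _ (hld _ _) hfs.lintegral_kernel_prod_right',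
      lintegral_withDensity_eq_lintegral_mul _ (hld _ _) hf, ← map_snoc_prod,
      lintegral_map ((hld _ _).mul hf) measurable_snoc,
      lintegral_prod (fun p : (Fin k → S) × S => ((fun x => ENNReal.ofReal (Real.exp
        (logDensity μ m φ (k + 1) hj x))) * f) (Fin.snoc (α := fun _ => S) p.1 p.2))
        (((hld (k + 1) hj).mul hf).comp measurable_snoc).aemeasurable]
    refine lintegral_congr fun x => ?_
    have hfx : Measurable fun y => f (Fin.snoc (α := fun _ => S) x y) :=
      hfs.comp measurable_prodMk_left
    have hdx := (measurable_density μ m hφ k hj).comp (measurable_prodMk_left (x := x))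
    rw [Pi.mul_apply, K, Kernel.lintegral_withDensity _ (measurable_density μ m hφ k hj) x hfx,
      Kernel.const_apply]
    refine (lintegral_const_mul _ (hdx.mul hfx)).symm.trans (lintegral_congr fun y => ?_)
    simp only [Pi.mul_apply, Function.comp_apply, Function.uncurry_apply_pair]
    rw [logDensity_snoc μ m φ k hj x y, Real.exp_add, ENNReal.ofReal_mul (Real.exp_pos _).le,
      mul_sub, Real.exp_sub, mul_assoc]

theorem integral_exp_logDensity (hm : m ∈ Delta n) (hφ : Measurable φ)
    (hC : ∀ x, |φ x| ≤ C) (j : ℕ) (hj : j ≤ n) :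
    ∫ x, Real.exp (logDensity μ m φ j hj x) ∂(marginal (Measure.pi μ) j hj) = 1 := by
  have h := (isProbabilityMeasure_chain μ hm.1 hφ hC j hj).measure_univ
  rw [chain_eq_withDensity μ hm.1 hφ hC, ← marginal_pi μ, withDensity_apply _ MeasurableSet.univ,
    Measure.restrict_univ, ← ofReal_integral_eq_lintegral_ofReal
      (integrable_exp_of_abs_le (measurable_logDensity μ m hφ j hj)
        (abs_logDensity_le μ hm hφ hC j hj))
      (Filter.Eventually.of_forall fun y => (Real.exp_pos _).le)] at h
  simpa using h

theorem isProbabilityMeasure_G (hm : m ∈ Delta n) (hφ : Measurable φ) (hC : ∀ x, |φ x| ≤ C) :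
    IsProbabilityMeasure (G μ φ m) :=
  isProbabilityMeasure_chain μ hm.1 hφ hC n le_rfl

/-- Every entropy involving `G` reduces through this to an integral of `logDensity`. -/
theorem marginal_G (hm : m ∈ Delta n) (hφ : Measurable φ) (hC : ∀ x, |φ x| ≤ C)
    (j : ℕ) (hj : j ≤ n) :
    marginal (G μ φ m) j hj =
      (marginal (Measure.pi μ) j hj).tilted (logDensity μ m φ j hj) := by
  rw [marginal_eq_map, G, map_pre_chain μ hm.1 hφ hC, chain_eq_withDensity μ hm.1 hφ hC,
    Measure.tilted, integral_exp_logDensity μ hm hφ hC, marginal_pi]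
  simp

end Chain

end PerceptronGREM

namespace PerceptronGREM

/-! ### Multipliers: summation by parts and one-coordinate perturbations. -/

section Multipliers

variable {n : ℕ}

/-- Abel summation; the boundary term at `n` will have coefficient `invSeq m n = 1`. -/
theorem sum_mul_eq_sum_sub_mul_sum (T : ℕ → ℝ) (a : Fin n → ℝ) :
    ∑ i : Fin n, T i * a i =
      ∑ j : Fin n, (T j - T (j + 1)) * ∑ i : Fin (j + 1), a (Fin.castLE j.isLt i) +
        T n * ∑ i, a i := by
  induction n with
  | zero => simp
  | succ k ih =>
    rw [Fin.sum_univ_castSucc, Fin.sum_univ_castSucc (n := k) (f := fun j : Fin (k + 1) =>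
      (T j - T (j + 1)) * ∑ i : Fin (j + 1), a (Fin.castLE j.isLt i))]
    have h1 := ih fun i => a i.castSucc
    have h2 : ∑ i : Fin (k + 1), a i = ∑ i : Fin k, a i.castSucc + a (Fin.last k) :=
      Fin.sum_univ_castSucc a
    have h3 : ∑ i : Fin ((Fin.last k : ℕ) + 1), a (Fin.castLE (Fin.last k).isLt i) =
      ∑ i : Fin (k + 1), a i := rfl
    simp only [Fin.val_castSucc] at h1 ⊢
    rw [h1, h3, h2]
    simp only [Fin.val_last]
    have h4 : ∀ j : Fin k, ∑ i : Fin (j + 1), a (Fin.castLE j.isLt i).castSucc =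
      ∑ i : Fin (j + 1), a (Fin.castLE j.castSucc.isLt i) := fun _ => rfl
    simp only [h4]
    ring

theorem Gam_eq_sum (γ : Fin n → ℝ) (j : Fin n) :
    Gam γ j = ∑ i : Fin (j + 1), γ (Fin.castLE j.isLt i) := by
  have : Finset.Iic j = Finset.univ.map (Fin.castLEEmb (n := j + 1) j.isLt) := by
    ext i
    simp only [Finset.mem_Iic, Finset.mem_map, Finset.mem_univ, true_and, Fin.castLEEmb_apply]
    exact ⟨fun h => ⟨⟨i, Nat.lt_succ_of_le h⟩, rfl⟩,
      fun ⟨k, hk⟩ => hk ▸ Nat.le_of_lt_succ k.isLt⟩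
  rw [Gam, this, Finset.sum_map]
  rfl

/-- The sequence `1/m₁, …, 1/mₙ, 1, 1, …`. -/
noncomputable def invSeq (m : Fin n → ℝ) (k : ℕ) : ℝ := if h : k < n then 1 / m ⟨k, h⟩ else 1

/-- The Lagrange multiplier of the constraint on the first `j + 1` coordinates. -/
noncomputable def mult (m : Fin n → ℝ) (j : Fin n) : ℝ := invSeq m j - invSeq m (j + 1)

theorem invSeq_coe (m : Fin n → ℝ) (i : Fin n) : invSeq m i = 1 / m i := dif_pos i.isLt

theorem invSeq_of_le (m : Fin n → ℝ) {k : ℕ} (hk : n ≤ k) : invSeq m k = 1 := dif_neg hk.not_gt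

theorem one_le_invSeq {m : Fin n → ℝ} (hm : m ∈ Delta n) (k : ℕ) : 1 ≤ invSeq m k := by
  unfold invSeq
  split_ifs with h
  · exact one_le_one_div (hm.1 _) (hm.2.2 _)
  · exact le_rfl

theorem antitone_invSeq {m : Fin n → ℝ} (hm : m ∈ Delta n) : Antitone (invSeq m) := by
  intro k l hkl
  by_cases hl : l < n
  · rw [invSeq, invSeq, dif_pos hl, dif_pos (hkl.trans_lt hl)]
    exact one_div_le_one_div_of_le (hm.1 _) (hm.2.1 hkl)
  · rw [invSeq_of_le m (not_lt.1 hl)]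
    exact one_le_invSeq hm k

theorem mult_nonneg {m : Fin n → ℝ} (hm : m ∈ Delta n) (j : Fin n) : 0 ≤ mult m j :=
  sub_nonneg.2 (antitone_invSeq hm (Nat.le_succ _))

/-- The parameter obtained from `m` by adding `ε` to the multiplier with index `j`. -/
noncomputable def perturb (m : Fin n → ℝ) (j : Fin n) (ε : ℝ) (i : Fin n) : ℝ :=
  1 / (1 / m i + if i ≤ j then ε else 0)

theorem perturb_zero (m : Fin n → ℝ) (j : Fin n) : perturb m j 0 = m := by
  ext i
  simp [perturb]

theorem invSeq_perturb (m : Fin n → ℝ) (j : Fin n) (ε : ℝ) (k : ℕ) :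
    invSeq (perturb m j ε) k = invSeq m k + if k ≤ j then ε else 0 := by
  by_cases hk : k < n
  · simp only [invSeq, dif_pos hk, perturb, one_div_one_div]
    rfl
  · rw [invSeq_of_le _ (not_lt.1 hk), invSeq_of_le _ (not_lt.1 hk),
      if_neg (by have := j.isLt; omega), add_zero]

theorem mult_perturb (m : Fin n → ℝ) (j : Fin n) (ε : ℝ) (i : Fin n) :
    mult (perturb m j ε) i = mult m i + if i = j then ε else 0 := by
  rw [mult, mult, invSeq_perturb, invSeq_perturb]
  rcases lt_trichotomy i j with h | rfl | h
  · have : (i : ℕ) < j := h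
    rw [if_pos (by omega), if_pos (by omega), if_neg h.ne]
    ring
  · simp
    ring
  · have : (j : ℕ) < i := h
    rw [if_neg (by omega), if_neg (by omega), if_neg h.ne']
    ring

/-- For `i ≤ j`, lowering `1/m i` by at most `mult m j` leaves at least `invSeq m (j + 1) ≥ 1`. -/
theorem one_le_invSeq_add {m : Fin n → ℝ} (hm : m ∈ Delta n) {j : Fin n} {ε : ℝ}
    (hε : -mult m j ≤ ε) (i : Fin n) : 1 ≤ 1 / m i + if i ≤ j then ε else 0 := by
  rw [← invSeq_coe]
  split_ifs with h
  · have h1 : invSeq m j ≤ invSeq m i := antitone_invSeq hm h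
    have h2 := one_le_invSeq hm (j + 1)
    unfold mult at hε
    linarith
  · linarith [one_le_invSeq hm i]

theorem perturb_mem_Delta {m : Fin n → ℝ} (hm : m ∈ Delta n) {j : Fin n} {ε : ℝ}
    (hε : -mult m j ≤ ε) : perturb m j ε ∈ Delta n := by
  have h1 := one_le_invSeq_add hm hε
  refine ⟨fun i => one_div_pos.2 (one_pos.trans_le (h1 i)), fun i k hik =>
    one_div_le_one_div_of_le (one_pos.trans_le (h1 k)) ?_, fun i => ?_⟩
  · rw [← invSeq_coe, ← invSeq_coe]
    have h2 : invSeq m k ≤ invSeq m i := antitone_invSeq hm hik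
    split_ifs with hk hi hi
    · linarith
    · exact absurd (hik.trans hk) hi
    -- Here `i ≤ j < k`, so the gap between `1/m i` and `1/m k` is at least `mult m j` and absorbs a
    -- negative `ε`.
    · have h3 : invSeq m j ≤ invSeq m i := antitone_invSeq hm hi
      have h4 : invSeq m k ≤ invSeq m (j + 1) := antitone_invSeq hm (not_le.1 hk)
      unfold mult at hε
      linarith
    · linarith
  · exact (div_le_one (one_pos.trans_le (h1 i))).2 (h1 i)

theorem continuousOn_perturb {m : Fin n → ℝ} (hm : m ∈ Delta n) (j : Fin n) :
    ContinuousOn (perturb m j) (Set.Ici (-mult m j)) := by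
  refine continuousOn_pi.2 fun i => continuousOn_const.div (continuousOn_const.add ?_) fun ε hε =>
    (one_pos.trans_le (one_le_invSeq_add hm hε i)).ne'
  split_ifs
  · exact continuousOn_id
  · exact continuousOn_const

/-- Replaces differentiation in the first order conditions: `g ε` has the sign of `ε`, and
continuity passes this to `0` from the right, and from the left when `s > 0`. -/
theorem nonneg_and_eq_zero_of_mul_nonneg {g : ℝ → ℝ} {s : ℝ} (hs : 0 ≤ s)
    (hg : ContinuousOn g (Set.Ici (-s))) (h : ∀ ε, -s ≤ ε → 0 ≤ ε * g ε) :
    0 ≤ g 0 ∧ (0 < s → g 0 = 0) := by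
  have h0 : ContinuousWithinAt g (Set.Ici (-s)) 0 := hg 0 (by simpa using hs)
  have hnn : 0 ≤ g 0 := by
    have : Filter.Tendsto g (nhdsWithin 0 (Set.Ioi 0)) (nhds (g 0)) :=
      h0.mono fun ε (hε : 0 < ε) => by
        show -s ≤ ε
        linarith
    refine ge_of_tendsto this (Filter.eventually_of_mem self_mem_nhdsWithin
      fun ε (hε : 0 < ε) => ?_)
    exact (mul_nonneg_iff_of_pos_left hε).1 (h ε (by linarith))
  refine ⟨hnn, fun hs' => le_antisymm ?_ hnn⟩
  have hc : ContinuousAt g 0 := h0.continuousAt (Ici_mem_nhds (by linarith))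
  have : Filter.Tendsto g (nhdsWithin 0 (Set.Iio 0)) (nhds (g 0)) := hc.mono_left nhdsWithin_le_nhds
  refine le_of_tendsto this ?_
  filter_upwards [self_mem_nhdsWithin,
    nhdsWithin_le_nhds (Ici_mem_nhds (show -s < (0 : ℝ) by linarith))] with ε hε hε'
  have hε0 : ε < 0 := hε
  by_contra! hpos
  exact (h ε hε').not_gt (mul_neg_of_neg_of_pos hε0 hpos)

end Multipliers

/-! ### The duality identity and the first order conditions. -/

section Duality

variable {S : Type*} [MeasurableSpace S] {n : ℕ}

/-- The relative entropy of the first `j` coordinates with respect to the product measure. -/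
noncomputable def ent (μ : Fin n → Measure S) (ν : Measure (Fin n → S)) (j : ℕ) (hj : j ≤ n) : ℝ :=
  (InformationTheory.klDiv (marginal ν j hj) (marginal (Measure.pi μ) j hj)).toReal

variable (μ : Fin n → Measure S) {m m' : Fin n → ℝ}
  {φ : (Fin n → S) → ℝ} {C : ℝ}

/-- Dividing `incr` by `m i` leaves the difference of consecutive `phi`, so the sum telescopes. -/
theorem eq_phi_zero_add_sum_incr (hm : ∀ i, 0 < m i) (x : Fin n → S) :
    φ x = phi μ m φ 0 (Nat.zero_le n) Fin.elim0 + ∑ i : Fin n, invSeq m i * incr μ m φ i x := by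
  let F : ℕ → ℝ := fun k => if h : k ≤ n then phi μ m φ k h (pre h x) else 0
  have hF : ∀ k (h : k ≤ n), F k = phi μ m φ k h (pre h x) := fun k h => dif_pos h
  have h1 : ∀ i : Fin n, invSeq m i * incr μ m φ i x = F (i + 1) - F i := fun i => by
    rw [invSeq_coe, incr, ← mul_assoc, one_div_mul_cancel (hm i).ne', one_mul, hF _ i.isLt,
      hF _ i.isLt.le]
  have h2 : pre (Nat.zero_le n) x = Fin.elim0 := Subsingleton.elim _ _
  rw [Finset.sum_congr rfl fun i _ => h1 i,
    ← Finset.sum_range (fun k => F (k + 1) - F k), Finset.sum_range_sub, hF _ le_rfl,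
    hF _ (Nat.zero_le n), h2, phi_self, pre_self]
  ring

theorem eq_phi_zero_add_sum_logDensity (hm : ∀ i, 0 < m i) (x : Fin n → S) :
    φ x = phi μ m φ 0 (Nat.zero_le n) Fin.elim0 +
      ∑ j : Fin n, mult m j * logDensity μ m φ (j + 1) j.isLt (pre j.isLt x) +
      logDensity μ m φ n le_rfl x := by
  rw [eq_phi_zero_add_sum_incr μ hm x (φ := φ), sum_mul_eq_sum_sub_mul_sum (invSeq m),
    invSeq_of_le m le_rfl, one_mul, ← add_assoc]
  rfl

/-- The boundary term of the summation by parts is `log 2`, as `∑ γ i = 1`; it cancels the `- log 2`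
in `parisi`. -/
theorem parisi_eq (γ : Fin n → ℝ) (hγ : ∑ i, γ i = 1) (m : Fin n → ℝ) :
    parisi μ γ φ m = phi μ m φ 0 (Nat.zero_le n) Fin.elim0 +
      ∑ j, mult m j * (Gam γ j * Real.log 2) := by
  have h1 : ∀ i, γ i * Real.log 2 / m i = invSeq m i * (γ i * Real.log 2) := fun i => by
    rw [invSeq_coe, one_div, inv_mul_eq_div]
  rw [parisi, Finset.sum_congr rfl fun i _ => h1 i, sum_mul_eq_sum_sub_mul_sum (invSeq m),
    invSeq_of_le m le_rfl, ← Finset.sum_mul, hγ]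
  have h2 : ∀ j : Fin n, (invSeq m j - invSeq m (j + 1)) *
      ∑ i : Fin (j + 1), γ (Fin.castLE j.isLt i) * Real.log 2 =
      mult m j * (Gam γ j * Real.log 2) := fun j => by
    rw [← Finset.sum_mul, Gam_eq_sum, mult]
  rw [Finset.sum_congr rfl fun j _ => h2 j]
  ring

variable [∀ i, IsProbabilityMeasure (μ i)]

theorem integral_logDensity_eq (hm : m ∈ Delta n) (hφ : Measurable φ) (hC : ∀ x, |φ x| ≤ C)
    (ν : Measure (Fin n → S)) [IsProbabilityMeasure ν] (j : ℕ) (hj : j ≤ n)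
    (hfin : InformationTheory.klDiv (marginal ν j hj) (marginal (Measure.pi μ) j hj) ≠ ⊤) :
    ∫ x, logDensity μ m φ j hj (pre hj x) ∂ν = ent μ ν j hj -
      (InformationTheory.klDiv (marginal ν j hj) (marginal (G μ φ m) j hj)).toReal := by
  rw [← integral_marginal ν hj (measurable_logDensity μ m hφ j hj), marginal_G μ hm hφ hC, ent,
    toReal_klDiv_eq_integral_add (measurable_logDensity μ m hφ j hj)
      (abs_logDensity_le μ hm hφ hC j hj) (integral_exp_logDensity μ hm hφ hC j hj) hfin]
  ring

theorem klDiv_marginal_G_ne_top (hm : m ∈ Delta n) (hφ : Measurable φ) (hC : ∀ x, |φ x| ≤ C)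
    (j : ℕ) (hj : j ≤ n) :
    InformationTheory.klDiv (marginal (G μ φ m) j hj) (marginal (Measure.pi μ) j hj) ≠ ⊤ := by
  rw [marginal_G μ hm hφ hC]
  exact klDiv_tilted_self_ne_top (measurable_logDensity μ m hφ j hj)
      (abs_logDensity_le μ hm hφ hC j hj)

theorem klDiv_G_ne_top (hm : m ∈ Delta n) (hφ : Measurable φ) (hC : ∀ x, |φ x| ≤ C) :
    InformationTheory.klDiv (G μ φ m) (Measure.pi μ) ≠ ⊤ := by
  have h := klDiv_marginal_G_ne_top μ hm hφ hC n le_rfl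
  rwa [marginal_self, marginal_self] at h

theorem ent_G (hm : m ∈ Delta n) (hφ : Measurable φ) (hC : ∀ x, |φ x| ≤ C) (j : ℕ) (hj : j ≤ n) :
    ent μ (G μ φ m) j hj = ∫ x, logDensity μ m φ j hj (pre hj x) ∂(G μ φ m) := by
  have := isProbabilityMeasure_G μ hm hφ hC
  rw [integral_logDensity_eq μ hm hφ hC _ j hj (klDiv_marginal_G_ne_top μ hm hφ hC j hj),
    InformationTheory.klDiv_self]
  simp

theorem G_eq_tilted (hm : m ∈ Delta n) (hφ : Measurable φ) (hC : ∀ x, |φ x| ≤ C) :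
    G μ φ m = (Measure.pi μ).tilted (logDensity μ m φ n le_rfl) := by
  have := marginal_G μ hm hφ hC n le_rfl
  rwa [marginal_self, marginal_self] at this

/-- Valid for any `m` in `Delta n`, not only a minimizer: this freedom yields both weak duality and
the subgradient inequality. -/
theorem integral_sub_ent_eq (hm : m ∈ Delta n) (hφ : Measurable φ) (hC : ∀ x, |φ x| ≤ C)
    (ν : Measure (Fin n → S)) [IsProbabilityMeasure ν]
    (hfin : ∀ j : Fin n, InformationTheory.klDiv (marginal ν (j + 1) j.isLt)
      (marginal (Measure.pi μ) (j + 1) j.isLt) ≠ ⊤)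
    (hfin_n : InformationTheory.klDiv ν (Measure.pi μ) ≠ ⊤) :
    ∫ x, φ x ∂ν - ent μ ν n le_rfl = phi μ m φ 0 (Nat.zero_le n) Fin.elim0 +
      ∑ j : Fin n, mult m j * (ent μ ν (j + 1) j.isLt - (InformationTheory.klDiv
        (marginal ν (j + 1) j.isLt) (marginal (G μ φ m) (j + 1) j.isLt)).toReal) -
      (InformationTheory.klDiv ν (G μ φ m)).toReal := by
  have hint : ∀ j (hj : j ≤ n), Integrable (fun x => logDensity μ m φ j hj (pre hj x)) ν :=
    fun j hj => integrable_of_abs_le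
      ((measurable_logDensity μ m hφ j hj).comp (measurable_pre hj))
      fun x => abs_logDensity_le μ hm hφ hC j hj _
  have hint_n : Integrable (logDensity μ m φ n le_rfl) ν := hint n le_rfl
  have hI : Integrable (fun x => ∑ j : Fin n, mult m j *
      logDensity μ m φ (j + 1) j.isLt (pre j.isLt x)) ν :=
    integrable_finsetSum _ fun j _ => (hint _ _).const_mul _
  have hI' : Integrable (fun x => phi μ m φ 0 (Nat.zero_le n) Fin.elim0 + ∑ j : Fin n, mult m j *
      logDensity μ m φ (j + 1) j.isLt (pre j.isLt x)) ν := (integrable_const _).add hI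
  have hn := integral_logDensity_eq μ hm hφ hC ν n le_rfl
    (by rwa [marginal_self, marginal_self])
  simp only [pre_self] at hn
  rw [marginal_self, marginal_self] at hn
  have hsum := fun j : Fin n =>
    integral_logDensity_eq μ hm hφ hC ν (j + 1) j.isLt (hfin j)
  simp only [← hsum]
  rw [integral_congr_ae (Filter.Eventually.of_forall
    (eq_phi_zero_add_sum_logDensity (φ := φ) μ hm.1)),
    integral_add hI' hint_n, integral_add (integrable_const _) hI,
    integral_finsetSum _ fun j _ => (hint _ _).const_mul _, hn]
  simp only [integral_const_mul, integral_const, probReal_univ, one_smul]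
  ring

theorem integral_G_sub_ent_eq (hm : m ∈ Delta n) (hφ : Measurable φ) (hC : ∀ x, |φ x| ≤ C) :
    ∫ x, φ x ∂(G μ φ m) - ent μ (G μ φ m) n le_rfl = phi μ m φ 0 (Nat.zero_le n) Fin.elim0 +
      ∑ j : Fin n, mult m j * ent μ (G μ φ m) (j + 1) j.isLt := by
  have := isProbabilityMeasure_G μ hm hφ hC
  rw [integral_sub_ent_eq μ hm hφ hC _ (fun _ => klDiv_marginal_G_ne_top μ hm hφ hC _ _)
    (klDiv_G_ne_top μ hm hφ hC)]
  simp [InformationTheory.klDiv_self]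

/-- A subgradient inequality for `parisi` as a function of the multipliers. -/
theorem parisi_sub_le (γ : Fin n → ℝ) (hγ : ∑ i, γ i = 1) (hm : m ∈ Delta n) (hm' : m' ∈ Delta n)
    (hφ : Measurable φ) (hC : ∀ x, |φ x| ≤ C) :
    parisi μ γ φ m' - parisi μ γ φ m ≤ ∑ j, (mult m' j - mult m j) *
      (Gam γ j * Real.log 2 - ent μ (G μ φ m') (j + 1) j.isLt) := by
  have := isProbabilityMeasure_G μ hm' hφ hC
  -- The identity for `m` is tested at `G μ φ m'`; the identity for `m'` then evaluates its left
  -- side.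
  have h := integral_sub_ent_eq μ hm hφ hC (G μ φ m') 
    (fun _ => klDiv_marginal_G_ne_top μ hm' hφ hC _ _) (klDiv_G_ne_top μ hm' hφ hC)
  rw [integral_G_sub_ent_eq μ hm' hφ hC] at h
  have h1 : ∑ j : Fin n, mult m j * (ent μ (G μ φ m') (j + 1) j.isLt - (InformationTheory.klDiv
        (marginal (G μ φ m') (j + 1) j.isLt) (marginal (G μ φ m) (j + 1) j.isLt)).toReal) ≤
      ∑ j : Fin n, mult m j * ent μ (G μ φ m') (j + 1) j.isLt :=
    Finset.sum_le_sum fun j _ => mul_le_mul_of_nonneg_left (sub_le_self _ ENNReal.toReal_nonneg)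
      (mult_nonneg hm j)
  have h2 : 0 ≤ (InformationTheory.klDiv (G μ φ m') (G μ φ m)).toReal := ENNReal.toReal_nonneg
  rw [parisi_eq μ γ hγ, parisi_eq μ γ hγ]
  simp only [sub_mul, mul_sub, Finset.sum_sub_distrib] at h h1 ⊢
  linarith

theorem continuousOn_ent_G (hφ : Measurable φ) (hC : ∀ x, |φ x| ≤ C) (j : ℕ) (hj : j ≤ n) :
    ContinuousOn (fun m => ent μ (G μ φ m) j hj) (Delta n) := by
  -- Moving the parameter from the measure into the integrand allows dominated convergence against
  -- the fixed product measure.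
  have heq : Set.EqOn (fun m => ent μ (G μ φ m) j hj) (fun m => ∫ x,
      Real.exp (logDensity μ m φ n le_rfl x) * logDensity μ m φ j hj (pre hj x) ∂(Measure.pi μ))
      (Delta n) := fun m hm => by
    have h1 := integral_exp_logDensity μ hm hφ hC n le_rfl
    rw [marginal_self] at h1
    simp only
    rw [ent_G μ hm hφ hC, G_eq_tilted μ hm hφ hC, integral_tilted]
    simp only [h1, div_one, smul_eq_mul]
  refine ContinuousOn.congr ?_ heq
  refine continuousOn_of_dominated
    (bound := fun _ => Real.exp (n * (2 * C)) * (j * (2 * C))) (fun m hm => ?_)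
    (fun m hm => Filter.Eventually.of_forall fun x => ?_) (integrable_const _)
    (Filter.Eventually.of_forall fun x => ?_)
  · exact ((measurable_logDensity μ m hφ n le_rfl).exp.mul
      ((measurable_logDensity μ m hφ j hj).comp (measurable_pre hj))).aestronglyMeasurable
  · rw [norm_mul, Real.norm_eq_abs, Real.norm_eq_abs, abs_of_pos (Real.exp_pos _)]
    exact mul_le_mul (Real.exp_le_exp.2 ((le_abs_self _).trans (abs_logDensity_le μ hm hφ hC _ _ _)))
      (abs_logDensity_le μ hm hφ hC _ _ _) (abs_nonneg _) (Real.exp_pos _).le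
  · exact (continuousOn_logDensity μ hφ hC _ _ _).rexp.mul (continuousOn_logDensity μ hφ hC _ _ _)

/-- The first order conditions at a minimizer of `parisi`. -/
theorem ent_G_le_of_isMinOn (γ : Fin n → ℝ) (hγ : ∑ i, γ i = 1) (hm : m ∈ Delta n)
    (hmin : IsMinOn (parisi μ γ φ) (Delta n) m) (hφ : Measurable φ) (hC : ∀ x, |φ x| ≤ C)
    (j : Fin n) :
    ent μ (G μ φ m) (j + 1) j.isLt ≤ Gam γ j * Real.log 2 ∧
      (0 < mult m j → ent μ (G μ φ m) (j + 1) j.isLt = Gam γ j * Real.log 2) := by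
  have hmem : ∀ ε ∈ Set.Ici (-mult m j), perturb m j ε ∈ Delta n :=
    fun ε hε => perturb_mem_Delta hm hε
  have h := nonneg_and_eq_zero_of_mul_nonneg
    (g := fun ε => Gam γ j * Real.log 2 - ent μ (G μ φ (perturb m j ε)) (j + 1) j.isLt)
    (mult_nonneg hm j)
    (continuousOn_const.sub
      ((continuousOn_ent_G μ hφ hC (j + 1) j.isLt).comp (continuousOn_perturb hm j) hmem))
    fun ε hε => by
      -- Only the multiplier `j` changes, so the subgradient bound reduces to `ε * g ε`; minimality
      -- makes it nonnegative.
      have h1 := parisi_sub_le μ γ hγ hm (hmem ε hε) hφ hC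
      simp only [mult_perturb, add_sub_cancel_left, ite_mul, zero_mul, Finset.sum_ite_eq',
        Finset.mem_univ, if_true] at h1
      exact (sub_nonneg.2 (hmin (hmem ε hε))).trans h1
  simp only [perturb_zero] at h
  exact ⟨sub_nonneg.1 h.1, fun hs => (sub_eq_zero.1 (h.2 hs)).symm⟩

end Duality

end PerceptronGREM

namespace PerceptronGREM

/-! ### Existence of a minimizer, and its uniqueness given `G`. -/

section Minimizer

variable {S : Type*} [MeasurableSpace S] {n : ℕ} (μ : Fin n → Measure S)
  [∀ i, IsProbabilityMeasure (μ i)] {m m' : Fin n → ℝ} {φ : (Fin n → S) → ℝ} {C : ℝ}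

theorem one_mem_Delta : (fun _ => 1 : Fin n → ℝ) ∈ Delta n :=
  ⟨fun _ => one_pos, monotone_const, fun _ => le_rfl⟩

theorem isCompact_Delta_inter {δ : ℝ} (hδ : 0 < δ) :
    IsCompact (Delta n ∩ {m | ∀ i, δ ≤ m i}) := by
  have : Delta n ∩ {m | ∀ i, δ ≤ m i} =
      Set.Icc (fun _ => δ) (fun _ => 1) ∩ {m | Monotone m} := by
    ext m
    exact ⟨fun h => ⟨⟨h.2, h.1.2.2⟩, h.1.2.1⟩,
      fun h => ⟨⟨fun i => hδ.trans_le (h.1.1 i), h.2, h.1.2⟩, h.1.1⟩⟩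
  rw [this]
  exact isCompact_Icc.inter_right isClosed_monotone

theorem continuousOn_parisi (γ : Fin n → ℝ) (hφ : Measurable φ) (hC : ∀ x, |φ x| ≤ C) :
    ContinuousOn (parisi μ γ φ) (Delta n) :=
  ((continuousOn_finsetSum _ fun i _ => continuousOn_const.div (continuous_apply i).continuousOn
    fun _ hm => (hm.1 i).ne').add (continuousOn_phi μ hφ hC _ _ _)).sub continuousOn_const

theorem exists_isMinOn_parisi [Nonempty (Fin n)] (γ : Fin n → ℝ) (hγ : ∀ i, 0 < γ i)
    (hγ_sum : ∑ i, γ i = 1)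
    (hφ : Measurable φ) (hC : ∀ x, |φ x| ≤ C) :
    ∃ m ∈ Delta n, IsMinOn (parisi μ γ φ) (Delta n) m := by
  have hlog : 0 < Real.log 2 := Real.log_pos one_lt_two
  have hC0 : 0 ≤ C :=
    (abs_nonneg _).trans (abs_phi_le μ one_mem_Delta.1 hφ hC 0 (Nat.zero_le n) Fin.elim0)
  obtain ⟨i₀, hi₀⟩ := Finite.exists_min γ
  -- If some `m i < δ`, then `γ i log 2 / m i ≥ 2C + log 2`, and `phi ≥ -C` makes `parisi` at least
  -- `C`, its upper bound at `m = 1`.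
  set δ := min 1 (γ i₀ * Real.log 2 / (2 * C + Real.log 2)) with hδ
  have hδ0 : 0 < δ := lt_min one_pos (div_pos (mul_pos (hγ _) hlog) (by linarith))
  have h1 : (fun _ => 1 : Fin n → ℝ) ∈ Delta n ∩ {m | ∀ i, δ ≤ m i} :=
    ⟨one_mem_Delta, fun _ => min_le_left _ _⟩
  obtain ⟨m, hm, hmin⟩ := (isCompact_Delta_inter hδ0).exists_isMinOn ⟨_, h1⟩
    ((continuousOn_parisi μ γ hφ hC).mono Set.inter_subset_left)
  refine ⟨m, hm.1, fun m' hm' => ?_⟩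
  by_cases hb : ∀ i, δ ≤ m' i
  · exact hmin ⟨hm', hb⟩
  push Not at hb
  obtain ⟨i, hi⟩ := hb
  refine (hmin h1).trans (?_ : parisi μ γ φ _ ≤ parisi μ γ φ m')
  have hone : parisi μ γ φ (fun _ => 1) ≤ C := by
    have := (abs_le.1 (abs_phi_le μ one_mem_Delta.1 hφ hC 0 (Nat.zero_le n) Fin.elim0)).2
    simp only [parisi, div_one, ← Finset.sum_mul, hγ_sum]
    linarith
  have hterm : γ i * Real.log 2 / m' i ≤ ∑ k, γ k * Real.log 2 / m' k :=
    Finset.single_le_sum (f := fun k => γ k * Real.log 2 / m' k)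
      (fun k _ => div_nonneg (mul_nonneg (hγ k).le hlog.le) (hm'.1 k).le) (Finset.mem_univ i)
  have hbig : 2 * C + Real.log 2 ≤ γ i * Real.log 2 / m' i := by
    rw [le_div_iff₀ (hm'.1 i), mul_comm]
    refine ((le_div_iff₀ (by linarith)).1 (hi.le.trans (min_le_right _ _))).trans ?_
    exact mul_le_mul_of_nonneg_right (hi₀ i) hlog.le
  have hlow := (abs_le.1 (abs_phi_le μ hm'.1 hφ hC 0 (Nat.zero_le n) Fin.elim0)).1
  unfold parisi at hone ⊢
  linarith

theorem Gam_lt_Gam {γ : Fin n → ℝ} (hγ : ∀ i, 0 < γ i) {i j : Fin n} (hij : i < j) :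
    Gam γ i < Gam γ j :=
  Finset.sum_lt_sum_of_subset (Finset.Iic_subset_Iic.2 hij.le) (i := j) (by simp)
    (by simpa using hij) (hγ j) fun k _ _ => (hγ k).le

theorem Gam_pos {γ : Fin n → ℝ} (hγ : ∀ i, 0 < γ i) (j : Fin n) : 0 < Gam γ j :=
  Finset.sum_pos (fun i _ => hγ i) ⟨j, by simp⟩

/-- The measure determines its density almost everywhere. -/
theorem ae_logDensity_eq (hm : m ∈ Delta n) (hm' : m' ∈ Delta n) (hφ : Measurable φ)
    (hC : ∀ x, |φ x| ≤ C) (hG : G μ φ m = G μ φ m') (j : ℕ) (hj : j ≤ n) :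
    ∀ᵐ x ∂(Measure.pi μ),
      logDensity μ m φ j hj (pre hj x) = logDensity μ m' φ j hj (pre hj x) := by
  have key : ∀ p ∈ Delta n, logDensity μ p φ j hj =ᵐ[marginal (Measure.pi μ) j hj] fun x =>
      Real.log (((marginal (G μ φ p) j hj).rnDeriv (marginal (Measure.pi μ) j hj) x).toReal) :=
    fun p hp => by
      have h := log_rnDeriv_tilted_left_self (μ := marginal (Measure.pi μ) j hj)
        (integrable_exp_of_abs_le (measurable_logDensity μ p hφ j hj)
          (abs_logDensity_le μ hp hφ hC j hj))
      rw [integral_exp_logDensity μ hp hφ hC, ← marginal_G μ hp hφ hC] at h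
      filter_upwards [h] with x hx
      rw [hx, Real.log_one, sub_zero]
  have h := (key m hm).trans (hG ▸ (key m' hm').symm)
  exact ae_of_ae_map (measurable_pre hj).aemeasurable h

theorem ae_incr_eq (hm : m ∈ Delta n) (hm' : m' ∈ Delta n) (hφ : Measurable φ)
    (hC : ∀ x, |φ x| ≤ C) (hG : G μ φ m = G μ φ m') :
    ∀ᵐ x ∂(Measure.pi μ), ∀ i, incr μ m φ i x = incr μ m' φ i x := by
  refine ae_all_iff.2 fun i => ?_
  filter_upwards [ae_logDensity_eq μ hm hm' hφ hC hG (i + 1) i.isLt,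
    ae_logDensity_eq μ hm hm' hφ hC hG i i.isLt.le] with x h1 h2
  rw [logDensity_succ_pre, logDensity_succ_pre] at h1
  linarith

/-- If the conditional density of a coordinate does not depend on that coordinate, then the
coordinate does not contribute to the entropy. -/
theorem ent_G_succ_le (hm : m ∈ Delta n) (hφ : Measurable φ) (hC : ∀ x, |φ x| ≤ C) (j : Fin n)
    {U : (Fin j → S) → ℝ} (hU : Measurable U)
    (h : ∀ᵐ x ∂(Measure.pi μ), incr μ m φ j x = U (pre j.isLt.le x)) :
    ent μ (G μ φ m) (j + 1) j.isLt ≤ ent μ (G μ φ m) j j.isLt.le := by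
  have := isProbabilityMeasure_G μ hm hφ hC
  have hinc : Integrable (incr μ m φ j) (G μ φ m) :=
    integrable_of_abs_le (measurable_incr μ m hφ j) (abs_incr_le μ hm hφ hC j)
  have hexp : Integrable (fun x => Real.exp (incr μ m φ j x)) (G μ φ m) :=
    integrable_exp_of_abs_le (measurable_incr μ m hφ j) (abs_incr_le μ hm hφ hC j)
  have hac : G μ φ m ≪ Measure.pi μ := by
    rw [G_eq_tilted μ hm hφ hC]
    exact tilted_absolutelyContinuous _ _
  -- As `incr` is a function `U` of the prefix, this integral can be computed on the prefix, where
  -- `e^{L_j} e^U` is the density of the next marginal, of mass one.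
  have hone : ∫ x, Real.exp (incr μ m φ j x) ∂(G μ φ m) = 1 := by
    have h1 : (fun x => Real.exp (incr μ m φ j x)) =ᵐ[G μ φ m]
        fun x => Real.exp (U (pre j.isLt.le x)) :=
      hac.ae_le (h.mono fun x hx => by simp only [hx])
    rw [integral_congr_ae h1, ← integral_marginal _ j.isLt.le hU.exp, marginal_G μ hm hφ hC,
      integral_exp_tilted, integral_exp_logDensity μ hm hφ hC, div_one,
      integral_marginal _ j.isLt.le ((measurable_logDensity μ m hφ _ _).add hU).exp,
      ← integral_exp_logDensity μ hm hφ hC (j + 1) j.isLt,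
      integral_marginal _ j.isLt (measurable_logDensity μ m hφ _ _).exp]
    refine integral_congr_ae (h.mono fun x hx => ?_)
    simp only [Pi.add_apply]
    rw [logDensity_succ_pre, hx]
  rw [ent_G μ hm hφ hC, ent_G μ hm hφ hC]
  simp only [logDensity_succ_pre]
  have hld : Integrable (fun x => logDensity μ m φ j j.isLt.le (pre j.isLt.le x)) (G μ φ m) :=
    integrable_of_abs_le ((measurable_logDensity μ m hφ _ _).comp (measurable_pre _))
      fun x => abs_logDensity_le μ hm hφ hC _ _ _
  rw [integral_add hld hinc]
  -- By `t ≤ e^t - 1`, the added entropy `∫ incr dG` is at most `0`.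
  have hle : ∫ x, incr μ m φ j x ∂(G μ φ m) ≤
      ∫ x, (Real.exp (incr μ m φ j x) - 1) ∂(G μ φ m) :=
    integral_mono hinc (hexp.sub (integrable_const _)) fun x => by
      linarith [Real.add_one_le_exp (incr μ m φ j x)]
  rw [integral_sub hexp (integrable_const _), hone] at hle
  simp at hle
  linarith

theorem eq_of_invSeq_eq (h : invSeq m = invSeq m') : m = m' := by
  ext i
  have := congrFun h i
  rwa [invSeq_coe, invSeq_coe, one_div, one_div, inv_inj] at this

theorem eq_of_G_eq {γ : Fin n → ℝ} (hγ : ∀ i, 0 < γ i) (hm : m ∈ Delta n) (hm' : m' ∈ Delta n)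
    (hφ : Measurable φ) (hC : ∀ x, |φ x| ≤ C) (hG : G μ φ m = G μ φ m')
    (hle : ∀ j : Fin n, ent μ (G μ φ m) (j + 1) j.isLt ≤ Gam γ j * Real.log 2)
    (hs : ∀ j : Fin n, 0 < mult m j → ent μ (G μ φ m) (j + 1) j.isLt = Gam γ j * Real.log 2)
    (hs' : ∀ j : Fin n, 0 < mult m' j →
      ent μ (G μ φ m) (j + 1) j.isLt = Gam γ j * Real.log 2) : m = m' := by
  have hlog : 0 < Real.log 2 := Real.log_pos one_lt_two
  refine eq_of_invSeq_eq ?_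
  by_contra hne
  obtain ⟨k, hk⟩ := Function.ne_iff.1 hne
  have hfin : ∀ k, invSeq m k ≠ invSeq m' k → k < n := fun k hk => by
    by_contra! hkn
    exact hk (by rw [invSeq_of_le m hkn, invSeq_of_le m' hkn])
  -- The last index of disagreement: all later terms drop out, and `mult m j ≠ mult m' j`, so one of
  -- the two is positive and constraint `j` is tight.
  obtain ⟨j, hj, hmax⟩ : ∃ j : Fin n, invSeq m j ≠ invSeq m' j ∧
      ∀ l, (j : ℕ) < l → invSeq m l = invSeq m' l := by
    classical
    have hj := Nat.findGreatest_spec (P := fun k => invSeq m k ≠ invSeq m' k) (hfin k hk).le hk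
    refine ⟨⟨_, hfin _ hj⟩, hj, fun l hl => ?_⟩
    by_contra hl'
    exact Nat.findGreatest_is_greatest hl (hfin l hl').le hl'
  have hmult : mult m j ≠ mult m' j := fun h => hj <| by
    unfold mult at h
    linarith [hmax (j + 1) (Nat.lt_succ_self _)]
  have hent : ent μ (G μ φ m) (j + 1) j.isLt = Gam γ j * Real.log 2 := by
    rcases (mult_nonneg hm j).eq_or_lt with h | h
    · exact hs' j ((mult_nonneg hm' j).lt_of_ne (h.trans_ne hmult))
    · exact hs j h
  -- The empty prefix has zero entropy; otherwise the preceding constraint applies and `Gam` is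
  -- strictly increasing.
  have hprev : ent μ (G μ φ m) j j.isLt.le < Gam γ j * Real.log 2 := by
    rcases Nat.eq_zero_or_pos (j : ℕ) with h0 | hpos
    · have hempty : IsEmpty (Fin j) := by rw [h0]; infer_instance
      rw [ent_G μ hm hφ hC]
      simp only [logDensity, Finset.univ_eq_empty, Finset.sum_empty, integral_zero]
      exact mul_pos (Gam_pos hγ j) hlog
    · obtain ⟨l, hl⟩ : ∃ l : Fin n, (l : ℕ) + 1 = j :=
        ⟨⟨j - 1, by omega⟩, Nat.sub_add_cancel hpos⟩
      have h1 := hle l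
      have h2 : ent μ (G μ φ m) (l + 1) l.isLt = ent μ (G μ φ m) j j.isLt.le := by
        congr 1
      rw [← h2]
      exact h1.trans_lt (mul_lt_mul_of_pos_right (Gam_lt_Gam hγ
        (show (l : ℕ) < j by omega)) hlog)
  -- `U` comes from equating the two expansions of `φ`, whose increments agree almost everywhere,
  -- and solving for `incr j`; what remains involves only earlier coordinates.
  refine (hent ▸ hprev).not_ge (ent_G_succ_le μ hm hφ hC j (U := fun y =>
    (phi μ m' φ 0 (Nat.zero_le n) Fin.elim0 - phi μ m φ 0 (Nat.zero_le n) Fin.elim0 -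
      ∑ i : Fin j, (invSeq m i - invSeq m' i) * (m (Fin.castLE j.isLt.le i) *
        (phi μ m φ (i + 1) (i.isLt.trans_le j.isLt.le) (pre i.isLt y) -
          phi μ m φ i (i.isLt.le.trans j.isLt.le) (pre i.isLt.le y)))) /
      (invSeq m j - invSeq m' j)) ?_ ?_)
  · refine ((Finset.measurable_fun_sum _ fun i _ => ?_).const_sub _).div_const _
    exact ((((measurable_phi μ m hφ _ _).comp (measurable_pre _)).sub
      ((measurable_phi μ m hφ _ _).comp (measurable_pre _))).const_mul _).const_mul _
  · filter_upwards [ae_incr_eq μ hm hm' hφ hC hG] with x hx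
    have h1 := eq_phi_zero_add_sum_incr (φ := φ) μ hm.1 x
    have h2 := eq_phi_zero_add_sum_incr (φ := φ) μ hm'.1 x
    simp only [← hx] at h2
    have h3 : ∑ i : Fin n, (invSeq m i - invSeq m' i) * incr μ m φ i x =
        ∑ i : Fin (j + 1), (invSeq m i - invSeq m' i) * incr μ m φ (Fin.castLE j.isLt i) x := by
      have : Finset.univ.map (Fin.castLEEmb (n := j + 1) j.isLt) ⊆ Finset.univ :=
        Finset.subset_univ _
      rw [← Finset.sum_subset this, Finset.sum_map]
      · rfl
      · intro i _ hi
        have hji : (j : ℕ) < i := by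
          by_contra! hij
          exact hi (Finset.mem_map.2 ⟨⟨i, Nat.lt_succ_of_le hij⟩, Finset.mem_univ _, rfl⟩)
        rw [hmax i hji, sub_self, zero_mul]
    rw [Fin.sum_univ_castSucc] at h3
    simp only [sub_mul, Finset.sum_sub_distrib] at h3
    rw [eq_div_iff (sub_ne_zero.2 hj)]
    have h4 : ∀ i : Fin j, m (Fin.castLE j.isLt.le i) *
        (phi μ m φ (i + 1) (i.isLt.trans_le j.isLt.le) (pre i.isLt (pre j.isLt.le x)) -
          phi μ m φ i (i.isLt.le.trans j.isLt.le) (pre i.isLt.le (pre j.isLt.le x))) =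
        incr μ m φ (Fin.castLE j.isLt i.castSucc) x := fun _ => rfl
    have h5 : Fin.castLE j.isLt (Fin.last j) = j := rfl
    simp only [h4, sub_mul, Finset.sum_sub_distrib]
    rw [h5] at h3
    simp only [Fin.val_castSucc, Fin.val_last] at h3
    linarith

end Minimizer

/-! ### Weak duality, equality at a minimizer, and the conclusion. -/

section Main

variable {S : Type*} [MeasurableSpace S] {n : ℕ} (μ : Fin n → Measure S)
  {γ : Fin n → ℝ} {m : Fin n → ℝ} {φ : (Fin n → S) → ℝ} {C : ℝ}

theorem klDiv_le_of_mem {ν : ProbabilityMeasure (Fin n → S)} (hν : ν ∈ ⋂ j, R μ γ j) (j : Fin n) :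
    InformationTheory.klDiv (marginal (ν : Measure (Fin n → S)) (j + 1) j.isLt)
      (marginal (Measure.pi μ) (j + 1) j.isLt) ≤ ENNReal.ofReal (Gam γ j * Real.log 2) :=
  Set.mem_iInter.1 hν j

theorem gibbs_eq_coe {ν : ProbabilityMeasure (Fin n → S)}
    (hν : InformationTheory.klDiv (ν : Measure (Fin n → S)) (Measure.pi μ) ≠ ⊤) :
    gibbs μ φ ν = ((∫ x, φ x ∂(ν : Measure (Fin n → S)) - ent μ ν n le_rfl : ℝ) : EReal) := by
  rw [gibbs, ent, marginal_self, marginal_self, EReal.coe_sub, EReal.coe_ennreal_toReal hν]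

variable [∀ i, IsProbabilityMeasure (μ i)]

theorem klDiv_ne_top_of_mem [Nonempty (Fin n)] {ν : ProbabilityMeasure (Fin n → S)}
    (hν : ν ∈ ⋂ j, R μ γ j) :
    InformationTheory.klDiv (ν : Measure (Fin n → S)) (Measure.pi μ) ≠ ⊤ := by
  obtain ⟨k, rfl⟩ : ∃ k, n = k + 1 :=
    Nat.exists_eq_succ_of_ne_zero (Fin.pos_iff_nonempty.2 ‹_›).ne'
  have h := ne_top_of_le_ne_top ENNReal.ofReal_ne_top (klDiv_le_of_mem μ hν (Fin.last k))
  simp only [Fin.val_last] at h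
  rwa [marginal_self, marginal_self] at h

/-- Keeping the divergence from `G` on the left makes weak duality strict unless `ν = G μ φ m`,
which gives uniqueness of the maximizer. -/
theorem integral_sub_ent_add_le [Nonempty (Fin n)] (hγ : ∀ i, 0 < γ i) (hγ_sum : ∑ i, γ i = 1)
    (hm : m ∈ Delta n) (hφ : Measurable φ) (hC : ∀ x, |φ x| ≤ C)
    {ν : ProbabilityMeasure (Fin n → S)} (hν : ν ∈ ⋂ j, R μ γ j) :
    ∫ x, φ x ∂(ν : Measure (Fin n → S)) - ent μ ν n le_rfl +
      (InformationTheory.klDiv (ν : Measure (Fin n → S)) (G μ φ m)).toReal ≤ parisi μ γ φ m := by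
  have hlog : 0 < Real.log 2 := Real.log_pos one_lt_two
  rw [integral_sub_ent_eq μ hm hφ hC ν
    (fun j => ne_top_of_le_ne_top ENNReal.ofReal_ne_top (klDiv_le_of_mem μ hν j))
    (klDiv_ne_top_of_mem μ hν), parisi_eq μ γ hγ_sum, sub_add_cancel]
  refine add_le_add le_rfl (Finset.sum_le_sum fun j _ =>
    mul_le_mul_of_nonneg_left ?_ (mult_nonneg hm j))
  have h1 : ent μ ν (j + 1) j.isLt ≤ Gam γ j * Real.log 2 :=
    ENNReal.toReal_le_of_le_ofReal (mul_pos (Gam_pos hγ j) hlog).le (klDiv_le_of_mem μ hν j)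
  exact (sub_le_self _ ENNReal.toReal_nonneg).trans h1

theorem gibbs_le_parisi [Nonempty (Fin n)] (hγ : ∀ i, 0 < γ i) (hγ_sum : ∑ i, γ i = 1)
    (hm : m ∈ Delta n) (hφ : Measurable φ) (hC : ∀ x, |φ x| ≤ C)
    {ν : ProbabilityMeasure (Fin n → S)} (hν : ν ∈ ⋂ j, R μ γ j) :
    gibbs μ φ ν ≤ ((parisi μ γ φ m : ℝ) : EReal) := by
  rw [gibbs_eq_coe μ (klDiv_ne_top_of_mem μ hν)]
  exact EReal.coe_le_coe_iff.2 (le_of_add_le_of_nonneg_left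
    (integral_sub_ent_add_le μ hγ hγ_sum hm hφ hC hν) ENNReal.toReal_nonneg)

theorem eq_G_of_parisi_le_gibbs [Nonempty (Fin n)] (hγ : ∀ i, 0 < γ i) (hγ_sum : ∑ i, γ i = 1)
    (hm : m ∈ Delta n) (hφ : Measurable φ) (hC : ∀ x, |φ x| ≤ C)
    {ν : ProbabilityMeasure (Fin n → S)} (hν : ν ∈ ⋂ j, R μ γ j)
    (h : ((parisi μ γ φ m : ℝ) : EReal) ≤ gibbs μ φ ν) :
    (ν : Measure (Fin n → S)) = G μ φ m := by
  have := isProbabilityMeasure_G μ hm hφ hC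
  have hfin := klDiv_ne_top_of_mem μ hν
  rw [gibbs_eq_coe μ hfin, EReal.coe_le_coe_iff] at h
  have h1 := integral_sub_ent_add_le μ hγ hγ_sum hm hφ hC hν
  have h2 : (InformationTheory.klDiv (ν : Measure (Fin n → S)) (G μ φ m)).toReal = 0 :=
    le_antisymm (by linarith) ENNReal.toReal_nonneg
  -- Finiteness is needed because `toReal` also sends `⊤` to `0`.
  have hfin' : InformationTheory.klDiv (ν : Measure (Fin n → S)) (G μ φ m) ≠ ⊤ := by
    rw [G_eq_tilted μ hm hφ hC]
    have hC' := abs_logDensity_le μ hm hφ hC n le_rfl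
    exact klDiv_tilted_ne_top (measurable_logDensity μ m hφ n le_rfl) hC' hfin
  exact InformationTheory.klDiv_eq_zero_iff.1
    (((ENNReal.toReal_eq_zero_iff _).1 h2).resolve_right hfin')

/-- The measure `G_{φ,m}` as a probability measure. -/
noncomputable def GProb (hm : m ∈ Delta n) (hφ : Measurable φ) (hC : ∀ x, |φ x| ≤ C) :
    ProbabilityMeasure (Fin n → S) :=
  ⟨G μ φ m, isProbabilityMeasure_G μ hm hφ hC⟩

theorem GProb_mem (hγ_sum : ∑ i, γ i = 1) (hm : m ∈ Delta n)
    (hmin : IsMinOn (parisi μ γ φ) (Delta n) m) (hφ : Measurable φ) (hC : ∀ x, |φ x| ≤ C) :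
    GProb μ hm hφ hC ∈ ⋂ j, R μ γ j := by
  refine Set.mem_iInter.2 fun j => ?_
  have h := (ent_G_le_of_isMinOn μ γ hγ_sum hm hmin hφ hC j).1
  exact (ENNReal.le_ofReal_iff_toReal_le (klDiv_marginal_G_ne_top μ hm hφ hC (j + 1) j.isLt)
    (ENNReal.toReal_nonneg.trans h)).2 h

/-- Complementary slackness: each multiplier is zero or its constraint is tight. -/
theorem gibbs_GProb (hγ_sum : ∑ i, γ i = 1) (hm : m ∈ Delta n)
    (hmin : IsMinOn (parisi μ γ φ) (Delta n) m) (hφ : Measurable φ) (hC : ∀ x, |φ x| ≤ C) :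
    gibbs μ φ (GProb μ hm hφ hC) = ((parisi μ γ φ m : ℝ) : EReal) := by
  rw [gibbs_eq_coe μ (ν := GProb μ hm hφ hC) (klDiv_G_ne_top μ hm hφ hC),
    parisi_eq μ γ hγ_sum, EReal.coe_eq_coe_iff]
  refine (integral_G_sub_ent_eq μ hm hφ hC).trans ?_
  congr 1
  refine Finset.sum_congr rfl fun j _ => ?_
  rcases (mult_nonneg hm j).eq_or_lt with h | h
  · rw [← h, zero_mul, zero_mul]
  · rw [(ent_G_le_of_isMinOn μ γ hγ_sum hm hmin hφ hC j).2 h]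

end Main

end PerceptronGREM

theorem mainTheorem4 {S : Type*} [TopologicalSpace S] [PolishSpace S] [MeasurableSpace S]
    [BorelSpace S] {n : ℕ} (μ : Fin n → MeasureTheory.Measure S)
    [∀ i, MeasureTheory.IsProbabilityMeasure (μ i)] (γ : Fin n → ℝ) (hγ : ∀ i, 0 < γ i)
    (hγ_sum : ∑ i, γ i = 1) (φ : (Fin n → S) → ℝ) (hφ : Continuous φ)
    (hφ_bdd : ∃ C : ℝ, ∀ x, |φ x| ≤ C) :
    (∃! ν : MeasureTheory.ProbabilityMeasure (Fin n → S),
      (ν ∈ ⋂ j, PerceptronGREM.R μ γ j) ∧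
        IsMaxOn (PerceptronGREM.gibbs μ φ) (⋂ j, PerceptronGREM.R μ γ j) ν) ∧
    (∃! m : Fin n → ℝ,
      m ∈ PerceptronGREM.Delta n ∧
        IsMinOn (PerceptronGREM.parisi μ γ φ) (PerceptronGREM.Delta n) m) ∧
    (∀ (ν : MeasureTheory.ProbabilityMeasure (Fin n → S)) (m : Fin n → ℝ),
      (ν ∈ ⋂ j, PerceptronGREM.R μ γ j) →
      IsMaxOn (PerceptronGREM.gibbs μ φ) (⋂ j, PerceptronGREM.R μ γ j) ν →
      m ∈ PerceptronGREM.Delta n →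
      IsMinOn (PerceptronGREM.parisi μ γ φ) (PerceptronGREM.Delta n) m →
        (ν : MeasureTheory.Measure (Fin n → S)) = PerceptronGREM.G μ φ m ∧
        PerceptronGREM.gibbs μ φ ν = ((PerceptronGREM.parisi μ γ φ m : ℝ) : EReal)) := by
  open PerceptronGREM in
  obtain ⟨C, hC⟩ := hφ_bdd
  have hφm : Measurable φ := hφ.measurable
  have : Nonempty (Fin n) := by
    by_contra h
    rw [not_nonempty_iff] at h
    simp at hγ_sum
  have hmax : ∀ m (hm : m ∈ Delta n), IsMinOn (parisi μ γ φ) (Delta n) m →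
      IsMaxOn (gibbs μ φ) (⋂ j, R μ γ j) (GProb μ hm hφm hC) := fun m hm hmin ν hν =>
    (gibbs_le_parisi μ hγ hγ_sum hm hφm hC hν).trans_eq
      (gibbs_GProb μ hγ_sum hm hmin hφm hC).symm
  have heq : ∀ (ν : MeasureTheory.ProbabilityMeasure (Fin n → S)) (m : Fin n → ℝ),
      (ν ∈ ⋂ j, R μ γ j) → IsMaxOn (gibbs μ φ) (⋂ j, R μ γ j) ν → m ∈ Delta n →
      IsMinOn (parisi μ γ φ) (Delta n) m →
        (ν : MeasureTheory.Measure (Fin n → S)) = G μ φ m ∧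
        gibbs μ φ ν = ((parisi μ γ φ m : ℝ) : EReal) := fun ν m hν hνmax hm hmin => by
    have h : ((parisi μ γ φ m : ℝ) : EReal) ≤ gibbs μ φ ν :=
      (gibbs_GProb μ hγ_sum hm hmin hφm hC).symm.trans_le
        (hνmax (GProb_mem μ hγ_sum hm hmin hφm hC))
    exact ⟨eq_G_of_parisi_le_gibbs μ hγ hγ_sum hm hφm hC hν h,
      (gibbs_le_parisi μ hγ hγ_sum hm hφm hC hν).antisymm h⟩
  obtain ⟨m, hm, hmin⟩ := exists_isMinOn_parisi μ γ hγ hγ_sum hφm hC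
  have hmem := GProb_mem μ hγ_sum hm hmin hφm hC
  refine ⟨⟨GProb μ hm hφm hC, ⟨hmem, hmax m hm hmin⟩, fun ν hν => ?_⟩,
    ⟨m, ⟨hm, hmin⟩, fun m' hm' => ?_⟩, heq⟩
  · exact Subtype.ext (heq ν m hν.1 hν.2 hm hmin).1
  -- The maximizer built from `m` must also be the one given by `m'`.
  · have hG : G μ φ m = G μ φ m' := (heq _ m' hmem (hmax m hm hmin) hm'.1 hm'.2).1
    have h := ent_G_le_of_isMinOn μ γ hγ_sum hm hmin hφm hC
    have h' := ent_G_le_of_isMinOn μ γ hγ_sum hm'.1 hm'.2 hφm hC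
    exact (eq_of_G_eq μ hγ hm hm'.1 hφm hC hG (fun j => (h j).1) (fun j => (h j).2)
      fun j => hG ▸ (h' j).2).symm
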